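/- Let $q\ge 1$ and let $(s_j)_{j=0}^\infty$ be a Stieltjes positive definite sequence of complex $q\times q$ matrices (in symbols, $(s_j)_{j=0}^\infty\in\mathcal K^{>}_{q,\infty}$), i.e. the block Hankel matrices $H_n=(s_{j+k})_{j,k=0}^n$ and $K_n=(s_{j+k+1})_{j,k=0}^n$ are positive definite Hermitian for all $n\ge 0$. **Resolvent matrices.** Let $y_n=(s_0;s_1;\dots;s_n)$ and $v_n=(I_q;0;\dots;0)$ (block columns with $n+1$ blocks), $u_0=0$ and $u_n=(0;-s_0;\dots;-s_{n-1})$ for $n\ge1$, $T_n=(\delta_{j,k+1}I_q)_{j,k=0}^n$ and $R_n(z)=(I-zT_n)^{-1}$. For $z\in\mathbb C$ put $$\alpha_n(z)=I_q-z\,u_n^*[R_n(\bar z)]^*H_n^{-1}v_n,\qquad \gamma_n(z)=-z\,v_n^*[R_n(\bar z)]^*H_n^{-1}v_n\qquad(n\ge 0),$$ $\beta_0=0$, $\delta_0=I_q$, and for $n\ge1$ $$\beta_n(z)=y_{n-1}^*[R_{n-1}(\bar z)]^*K_{n-1}^{-1}y_{n-1},\qquad \delta_n(z)=I_q-z\,v_{n-1}^*[R_{n-1}(\bar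 z)]^*K_{n-1}^{-1}y_{n-1}.$$ Dyukarev's resolvent matrices of $(s_j)$ are the $2q\times 2q$ matrix polynomials $$U_{2n}=\begin{pmatrix}\alpha_n&\beta_n\\ \gamma_n&\delta_n\end{pmatrix},\qquad U_{2n+1}=\begin{pmatrix}\alpha_n&\beta_{n+1}\\ \gamma_n&\delta_{n+1}\end{pmatrix}\qquad(n\ge0).$$ **Transformed sequences.** With $A^\dagger$ the Moore–Penrose inverse of $A$, the reciprocal sequence of $(s_j)$ is given by $s_0^\sharp=s_0^\dagger$ and $s_j^\sharp=-s_0^\dagger\sum_{l=0}^{j-1}s_{j-l}s_l^\sharp$ for $j\ge1$. The first Schur-type (Stieltjes) transform of $(s_j)$ is $s_j^{[1]}=-s_0s_{j+1}^\sharp s_0$, $j\ge 0$. The $0$-th transform of $(s_j)$ is $(s_j)$ itself, and for $k\ge1$ the $k$-th transform $(s^{[k]}_j)_{j=0}^\infty$ is the first transform of the $(k-1)$-th one. For $0\le \ell\le k$ let $U^{[\ell]}_k$ be the resolvent matrix with index $k-\ell$ of the $\ell$-th transform $(s^{[\ell]}_j)_{j=0}^\infty$; in particular $U^{[0]}_k=U_k$.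 For $\ell\ge 0$ let $$\mathfrak Q_\ell(z)=Q_0^{(0)}(z)\,Q_0^{(1)}(z)\cdots Q_0^{(\ell)}(z),\qquad Q_0^{(k)}(z)=\begin{pmatrix}0&s_0^{[k]}\\ -z\,\bigl[(s_0^{[k]})^{-1}\bigr]^*&0\end{pmatrix}.$$ **Claim.** All transformed sequences $(s^{[k]}_j)_{j=0}^\infty$, $k\ge0$, are Stieltjes positive definite (so that all matrices above are well defined), and for all $m\ge1$, all $\ell\in\{0,\dots,m-1\}$ and all $z\in\mathbb C\setminus\{0\}$ the matrix $\mathfrak Q_\ell(z)$ is invertible and $$U^{[0]}_m(z)=U^{[0]}_\ell(z)\,\mathfrak Q_\ell(z)\,U^{[\ell+1]}_m(z)\,\mathfrak Q_\ell(z)^{-1}.$$ -/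

import Mathlib

open scoped Matrix ComplexOrder

noncomputable section

namespace StieltjesResolvent

/-- `G` satisfies the four Penrose equations for the square complex matrix `A`. -/
def IsMoorePenrose {q : ℕ} (A G : Matrix (Fin q) (Fin q) ℂ) : Prop :=
  A * G * A = A ∧ G * A * G = G ∧ (A * G)ᴴ = A * G ∧ (G * A)ᴴ = G * A

/-- The solution of the four Penrose equations exists. -/
theorem exists_isMoorePenrose {q : ℕ} (A : Matrix (Fin q) (Fin q) ℂ) :
    ∃ G, IsMoorePenrose A G := by
  obtain ⟨N, hN, h1, h2, h3⟩ : ∃ N : Matrix (Fin q) (Fin q) ℂ, Nᴴ = N ∧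
      N * (Aᴴ * A) * N = N ∧ (Aᴴ * A) * N * (Aᴴ * A) = Aᴴ * A ∧
      (Aᴴ * A) * N = N * (Aᴴ * A) := by
    have hM := Matrix.isHermitian_conjTranspose_mul_self A
    set U : Matrix (Fin q) (Fin q) ℂ := (hM.eigenvectorUnitary : Matrix (Fin q) (Fin q) ℂ) with hU
    set d : Fin q → ℂ := fun i => (hM.eigenvalues i : ℂ) with hd
    have hUU : Uᴴ * U = 1 := Unitary.coe_star_mul_self hM.eigenvectorUnitary
    have hspec : Aᴴ * A = U * Matrix.diagonal d * Uᴴ := by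
      have := hM.spectral_theorem
      rw [Unitary.conjStarAlgAut_apply] at this
      exact this
    have key : ∀ D E : Matrix (Fin q) (Fin q) ℂ, U * D * Uᴴ * (U * E * Uᴴ) = U * (D * E) * Uᴴ := by
      intro D E
      calc U * D * Uᴴ * (U * E * Uᴴ) = U * D * (Uᴴ * U) * E * Uᴴ := by simp only [Matrix.mul_assoc]
        _ = _ := by rw [hUU]; simp only [Matrix.mul_assoc, Matrix.one_mul]
    refine ⟨U * Matrix.diagonal (fun i => (d i)⁻¹) * Uᴴ, ?_, ?_, ?_, ?_⟩
    · simp only [Matrix.conjTranspose_mul, Matrix.conjTranspose_conjTranspose,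
        Matrix.diagonal_conjTranspose, Matrix.mul_assoc]
      congr 3
      ext i
      simp [hd]
    · rw [hspec, key, key, Matrix.diagonal_mul_diagonal, Matrix.diagonal_mul_diagonal]
      congr 3
      ext i
      by_cases h : d i = 0 <;> simp [h]
    · rw [hspec, key, key, Matrix.diagonal_mul_diagonal, Matrix.diagonal_mul_diagonal]
      congr 3
      ext i
      by_cases h : d i = 0 <;> simp [h]
    · rw [hspec, key, key, Matrix.diagonal_mul_diagonal, Matrix.diagonal_mul_diagonal]
      simp only [mul_comm]
  have hz : A * N * (Aᴴ * A) - A = 0 := by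
    rw [← Matrix.conjTranspose_mul_self_eq_zero]
    have e : A * N * (Aᴴ * A) - A = A * (N * (Aᴴ * A) - 1) := by
      rw [Matrix.mul_sub, Matrix.mul_one, Matrix.mul_assoc]
    have e2 : Aᴴ * (A * (N * (Aᴴ * A) - 1)) = 0 := by
      rw [← Matrix.mul_assoc, Matrix.mul_sub, Matrix.mul_one, ← Matrix.mul_assoc (Aᴴ * A), h2,
        sub_self]
    rw [e, Matrix.conjTranspose_mul, Matrix.mul_assoc, e2, Matrix.mul_zero]
  refine ⟨N * Aᴴ, ?_, ?_, ?_, ?_⟩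
  · rw [← sub_eq_zero, ← hz]; simp only [Matrix.mul_assoc]
  · calc N * Aᴴ * A * (N * Aᴴ) = N * (Aᴴ * A) * N * Aᴴ := by simp only [Matrix.mul_assoc]
      _ = _ := by rw [h1]
  · simp only [Matrix.conjTranspose_mul, Matrix.conjTranspose_conjTranspose, hN, Matrix.mul_assoc]
  · rw [Matrix.mul_assoc, Matrix.conjTranspose_mul, hN, Matrix.conjTranspose_mul,
      Matrix.conjTranspose_conjTranspose, h3]

/-- The solution of the four Penrose equations is unique. -/
theorem IsMoorePenrose.unique {q : ℕ} {A G G' : Matrix (Fin q) (Fin q) ℂ}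
    (h : IsMoorePenrose A G) (h' : IsMoorePenrose A G') : G = G' := by
  obtain ⟨a1, a2, a3, a4⟩ := h
  obtain ⟨b1, b2, b3, b4⟩ := h'
  have e1 : A * G = A * G' := by
    calc A * G = (A * G)ᴴ := a3.symm
      _ = (A * G' * (A * G))ᴴ := by rw [← Matrix.mul_assoc, b1]
      _ = A * G * (A * G') := by rw [Matrix.conjTranspose_mul, a3, b3]
      _ = A * G' := by rw [← Matrix.mul_assoc, a1]
  have e2 : G * A = G' * A := by
    calc G * A = (G * A)ᴴ := a4.symm
      _ = (G * A * (G' * A))ᴴ := by rw [Matrix.mul_assoc, ← Matrix.mul_assoc A, b1]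
      _ = G' * A * (G * A) := by rw [Matrix.conjTranspose_mul, a4, b4]
      _ = G' * A := by rw [Matrix.mul_assoc, ← Matrix.mul_assoc A, a1]
  calc G = G * A * G := a2.symm
    _ = G' * (A * G) := by rw [e2, Matrix.mul_assoc]
    _ = G' := by rw [e1, ← Matrix.mul_assoc, b2]

/-- The Moore-Penrose inverse of a square complex matrix. -/
def moorePenrose {q : ℕ} (A : Matrix (Fin q) (Fin q) ℂ) : Matrix (Fin q) (Fin q) ℂ :=
  (exists_isMoorePenrose A).choose

theorem moorePenrose_spec {q : ℕ} (A : Matrix (Fin q) (Fin q) ℂ) :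
    IsMoorePenrose A (moorePenrose A) :=
  (exists_isMoorePenrose A).choose_spec

/-! ### Block matrices built from a sequence of complex `q × q` matrices

A block matrix with `(n+1) × (n+1)` blocks of size `q × q` is indexed by
`Fin (n + 1) × Fin q` (block index, index inside the block). -/

/-- The block Hankel matrix `H_n = (s_{j+k})_{j,k=0}^n`. -/
def hankelH {q : ℕ} (s : ℕ → Matrix (Fin q) (Fin q) ℂ) (n : ℕ) :
    Matrix (Fin (n + 1) × Fin q) (Fin (n + 1) × Fin q) ℂ :=
  Matrix.of fun a b => s ((a.1 : ℕ) + (b.1 : ℕ)) a.2 b.2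

/-- The block Hankel matrix `K_n = (s_{j+k+1})_{j,k=0}^n`. -/
def hankelK {q : ℕ} (s : ℕ → Matrix (Fin q) (Fin q) ℂ) (n : ℕ) :
    Matrix (Fin (n + 1) × Fin q) (Fin (n + 1) × Fin q) ℂ :=
  Matrix.of fun a b => s ((a.1 : ℕ) + (b.1 : ℕ) + 1) a.2 b.2

/-- Infinite Stieltjes positive definite sequences: every initial section is Stieltjes positive
definite, that is, all the block Hankel matrices `H_n` and `K_n` are positive definite
Hermitian matrices. -/
def IsStieltjesPosDef {q : ℕ} (s : ℕ → Matrix (Fin q) (Fin q) ℂ) : Prop :=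
  ∀ n : ℕ, (hankelH s n).PosDef ∧ (hankelK s n).PosDef

/-- The block column `y_{0,n} = (s_0; s_1; …; s_n)`. -/
def colY {q : ℕ} (s : ℕ → Matrix (Fin q) (Fin q) ℂ) (n : ℕ) :
    Matrix (Fin (n + 1) × Fin q) (Fin q) ℂ :=
  Matrix.of fun a j => s (a.1 : ℕ) a.2 j

/-- The block column `v_n = (I; 0; …; 0)` with `n + 1` blocks. -/
def colV (q n : ℕ) : Matrix (Fin (n + 1) × Fin q) (Fin q) ℂ :=
  Matrix.of fun a j => if a.1 = 0 then (1 : Matrix (Fin q) (Fin q) ℂ) a.2 j else 0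

/-- The block column `u_n = (0; -s_0; …; -s_{n-1})` with `n + 1` blocks; `u_0 = 0`. -/
def colU {q : ℕ} (s : ℕ → Matrix (Fin q) (Fin q) ℂ) (n : ℕ) :
    Matrix (Fin (n + 1) × Fin q) (Fin q) ℂ :=
  Matrix.of fun a j => if a.1 = 0 then 0 else -(s ((a.1 : ℕ) - 1) a.2 j)

/-- The block shift matrix `T_n = (δ_{j,k+1} I_q)_{j,k=0}^n`. -/
def shiftT (q n : ℕ) : Matrix (Fin (n + 1) × Fin q) (Fin (n + 1) × Fin q) ℂ :=
  Matrix.of fun a b =>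
    if (a.1 : ℕ) = (b.1 : ℕ) + 1 then (1 : Matrix (Fin q) (Fin q) ℂ) a.2 b.2 else 0

/-- `R_n(z) = (I - z T_n)⁻¹`; the matrix `I - z T_n` is unipotent, hence invertible. -/
def resolventR (q n : ℕ) (z : ℂ) : Matrix (Fin (n + 1) × Fin q) (Fin (n + 1) × Fin q) ℂ :=
  (1 - z • shiftT q n)⁻¹

/-! ### Dyukarev's resolvent matrices -/

/-- `α_n(z) = I - z u_n^* [R_n(z̄)]^* H_n⁻¹ v_n`. -/
def alphaPoly {q : ℕ} (s : ℕ → Matrix (Fin q) (Fin q) ℂ) (n : ℕ) (z : ℂ) :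
    Matrix (Fin q) (Fin q) ℂ :=
  1 - z • ((colU s n)ᴴ * (resolventR q n (star z))ᴴ * (hankelH s n)⁻¹ * colV q n)

/-- `γ_n(z) = -z v_n^* [R_n(z̄)]^* H_n⁻¹ v_n`. -/
def gammaPoly {q : ℕ} (s : ℕ → Matrix (Fin q) (Fin q) ℂ) (n : ℕ) (z : ℂ) :
    Matrix (Fin q) (Fin q) ℂ :=
  -(z • ((colV q n)ᴴ * (resolventR q n (star z))ᴴ * (hankelH s n)⁻¹ * colV q n))

/-- `β_0(z) = 0` and `β_n(z) = y_{0,n-1}^* [R_{n-1}(z̄)]^* K_{n-1}⁻¹ y_{0,n-1}` for `n ≥ 1`. -/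
def betaPoly {q : ℕ} (s : ℕ → Matrix (Fin q) (Fin q) ℂ) (n : ℕ) (z : ℂ) :
    Matrix (Fin q) (Fin q) ℂ :=
  match n with
  | 0 => 0
  | k + 1 => (colY s k)ᴴ * (resolventR q k (star z))ᴴ * (hankelK s k)⁻¹ * colY s k

/-- `δ_0(z) = I` and `δ_n(z) = I - z v_{n-1}^* [R_{n-1}(z̄)]^* K_{n-1}⁻¹ y_{0,n-1}` for `n ≥ 1`. -/
def deltaPoly {q : ℕ} (s : ℕ → Matrix (Fin q) (Fin q) ℂ) (n : ℕ) (z : ℂ) :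
    Matrix (Fin q) (Fin q) ℂ :=
  match n with
  | 0 => 1
  | k + 1 => 1 - z • ((colV q k)ᴴ * (resolventR q k (star z))ᴴ * (hankelK s k)⁻¹ * colY s k)

/-- Dyukarev's resolvent matrix `U_m(z)` of the sequence `s`: the block matrix
`(α_n, β_n; γ_n, δ_n)` if `m = 2n` and `(α_n, β_{n+1}; γ_n, δ_{n+1})` if `m = 2n + 1`. -/
def dyukarevU {q : ℕ} (s : ℕ → Matrix (Fin q) (Fin q) ℂ) (m : ℕ) (z : ℂ) :
    Matrix (Fin q ⊕ Fin q) (Fin q ⊕ Fin q) ℂ :=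
  Matrix.fromBlocks
    (alphaPoly s (m / 2) z) (betaPoly s ((m + 1) / 2) z)
    (gammaPoly s (m / 2) z) (deltaPoly s ((m + 1) / 2) z)

/-! ### The Schur-type (Stieltjes) transformation -/

/-- The reciprocal sequence: `s_0^♯ = s_0^†` and `s_j^♯ = -s_0^† ∑_{l=0}^{j-1} s_{j-l} s_l^♯`
for `j ≥ 1`, where `†` is the Moore-Penrose inverse. -/
def reciprocalSeq {q : ℕ} (s : ℕ → Matrix (Fin q) (Fin q) ℂ) : ℕ → Matrix (Fin q) (Fin q) ℂ
  | 0 => moorePenrose (s 0)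
  | j + 1 => -(moorePenrose (s 0)) * ∑ l : Fin (j + 1), s (j + 1 - l) * reciprocalSeq s l
  termination_by j => j
  decreasing_by exact l.isLt

/-- The first transform: `s_j^{[1]} = -s_0 s_{j+1}^♯ s_0`. -/
def firstTransform {q : ℕ} (s : ℕ → Matrix (Fin q) (Fin q) ℂ) (j : ℕ) :
    Matrix (Fin q) (Fin q) ℂ :=
  -(s 0) * reciprocalSeq s (j + 1) * s 0

/-- The `k`-th transform: the first transform applied `k` times. -/
def transform {q : ℕ} (s : ℕ → Matrix (Fin q) (Fin q) ℂ) : ℕ → ℕ → Matrix (Fin q) (Fin q) ℂ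
  | 0 => s
  | k + 1 => firstTransform (transform s k)

/-- `U^{[l]}_k`, used for `l ≤ k`: the resolvent matrix with index `k - l` of the `l`-th
transform of `s`. -/
def resolventU {q : ℕ} (s : ℕ → Matrix (Fin q) (Fin q) ℂ) (l k : ℕ) (z : ℂ) :
    Matrix (Fin q ⊕ Fin q) (Fin q ⊕ Fin q) ℂ :=
  dyukarevU (transform s l) (k - l) z

/-- The matrix `Q_0(z) = (0, s_0; -z (s_0⁻¹)^*, 0)` of the sequence `s`. Here `s_0` is the (constant)
value of the matrix polynomial of the second kind with index `0` belonging to the shifted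
sequence `(s_{j+1})`. -/
def factorQ {q : ℕ} (s : ℕ → Matrix (Fin q) (Fin q) ℂ) (z : ℂ) :
    Matrix (Fin q ⊕ Fin q) (Fin q ⊕ Fin q) ℂ :=
  Matrix.fromBlocks 0 (s 0) (-(z • ((s 0)⁻¹)ᴴ)) 0

/-- The ordered product `𝔔_l(z) = Q_0^{(0)}(z) Q_0^{(1)}(z) ⋯ Q_0^{(l)}(z)`, where `Q_0^{(k)}`
is the matrix `Q_0` of the `k`-th transform of `s`. -/
def frakQ {q : ℕ} (s : ℕ → Matrix (Fin q) (Fin q) ℂ) : ℕ → ℂ →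
    Matrix (Fin q ⊕ Fin q) (Fin q ⊕ Fin q) ℂ
  | 0, z => factorQ (transform s 0) z
  | l + 1, z => frakQ s l z * factorQ (transform s (l + 1)) z

end StieltjesResolvent

end

noncomputable section

namespace StieltjesResolvent

open PowerSeries

/-! ### Toeplitz and Hankel matrices over a ring -/

section Toeplitz

variable {R : Type*} [Ring R]

/-! Write `S` for the generating series of `s`, `T = S⁻¹` for that of the reciprocal sequence
(coefficients `t_j`), `G = ∑ z^k X^k`, and `s'` for the first transform, with series `S'`.
Everything follows from the one-step relation `U_{m+1}(s) Q = U_0(s) Q U_m(s')` with `Q = factorQ s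
z`, which telescopes over the successive transforms (`dyukarevU_mul_frakQ`).

Blocks are treated as entries in the ring of `q × q` matrices, where truncation of series to upper
Toeplitz matrices is multiplicative. Splitting the convolution in `T * S = 1` shows that multiplying
the Hankel matrices of `s` by the Toeplitz matrices of `T` on both sides gives Hankel matrices of
`T`, and hence, after scaling by `s_0`, those of `s'`. This yields positivity of `s'` by congruence,
and it carries solutions of Hankel systems between `s` and `s'`.

Since `[R_n(z̄)]^*` is the Toeplitz matrix of `G`, each of `α, β, γ, δ` is, up to explicit constants
and factors of `z`, the first entry of a Toeplitz matrix applied to a solution of a Hankel system.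
The four block relations between `s` and `s'` thus become series identities based on `X * S' = s_0 -
s_0 * T * s_0`. -/

/-- The upper triangular Toeplitz matrix whose first row holds the coefficients of a series. -/
def upperToeplitz (n : ℕ) (F : PowerSeries R) : Matrix (Fin n) (Fin n) R :=
  Matrix.of fun i j => if (i : ℕ) ≤ j then coeff ((j : ℕ) - i) F else 0

/-- The lower triangular Toeplitz matrix whose first column holds the coefficients of a series. -/
def lowerToeplitz (n : ℕ) (F : PowerSeries R) : Matrix (Fin n) (Fin n) R :=
  Matrix.of fun i j => if (j : ℕ) ≤ i then coeff ((i : ℕ) - j) F else 0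

/-- The Hankel matrix `(f (i + j + k))`. -/
def hankelMat (n : ℕ) (f : ℕ → R) (k : ℕ) : Matrix (Fin n) (Fin n) R :=
  Matrix.of fun i j => f (i + j + k)

/-- The Hankel matrix `(-f (i + j))` with first row and column replaced by `(f 0, 0, …, 0)`. -/
def borderedHankel (n : ℕ) (f : ℕ → R) : Matrix (Fin n) (Fin n) R :=
  Matrix.of fun i j =>
    if (i : ℕ) = 0 then (if (j : ℕ) = 0 then f 0 else 0)
    else (if (j : ℕ) = 0 then 0 else -f (i + j))

theorem sum_fin_ite_le {A : Type*} [AddCommMonoid A] {n i : ℕ} (hi : i < n) (f : ℕ → A) :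
    ∑ a : Fin n, (if (a : ℕ) ≤ i then f a else 0) = ∑ a ∈ Finset.range (i + 1), f a := by
  rw [Fin.sum_univ_eq_sum_range (fun a => if a ≤ i then f a else 0) n,
    ← Finset.sum_subset (Finset.range_mono (Nat.succ_le_of_lt hi))]
  · refine Finset.sum_congr rfl fun a ha => if_pos ?_
    have := Finset.mem_range.1 ha
    omega
  · intro a _ ha
    rw [if_neg]
    simp only [Finset.mem_range] at ha
    omega

theorem coeff_mul_eq_sum_range (F G : PowerSeries R) (n : ℕ) :
    coeff n (F * G) = ∑ p ∈ Finset.range (n + 1), coeff p F * coeff (n - p) G := by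
  rw [coeff_mul, Finset.Nat.sum_antidiagonal_eq_sum_range_succ_mk]

/-- Only `i ≤ k ≤ j` contributes to entry `(i, j)`, and substituting `p = k - i` gives the
convolution of degree `j - i`. Series identities therefore pass to all finite truncations, without
commutativity. -/
theorem upperToeplitz_mul (n : ℕ) (F G : PowerSeries R) :
    upperToeplitz n F * upperToeplitz n G = upperToeplitz n (F * G) := by
  ext i j
  simp only [Matrix.mul_apply, upperToeplitz, Matrix.of_apply]
  have hj := j.isLt
  split_ifs with hij
  · have h1 : ∀ k : Fin n, ((if (i : ℕ) ≤ k then coeff ((k : ℕ) - i) F else 0) *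
        if (k : ℕ) ≤ j then coeff ((j : ℕ) - k) G else 0) =
        if (k : ℕ) ≤ j then ((if (i : ℕ) ≤ k then coeff ((k : ℕ) - i) F else 0) *
          coeff ((j : ℕ) - k) G) else 0 := by
      intro k
      rw [mul_ite, mul_zero]
    rw [Finset.sum_congr rfl fun k _ => h1 k,
      sum_fin_ite_le hj (fun k => (if (i : ℕ) ≤ k then coeff (k - i) F else 0) *
          coeff ((j : ℕ) - k) G),
      show (j : ℕ) + 1 = i + (j - i + 1) by omega, Finset.sum_range_add,
      Finset.sum_eq_zero, zero_add, coeff_mul_eq_sum_range]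
    · refine Finset.sum_congr rfl fun p _ => ?_
      rw [if_pos (by omega), show (i : ℕ) + p - i = p by omega,
        show (j : ℕ) - (i + p) = j - i - p by omega]
    · intro p hp
      rw [if_neg (by simpa using hp), zero_mul]
  · refine Finset.sum_eq_zero fun k _ => ?_
    by_cases h : (i : ℕ) ≤ k
    · rw [if_neg (show ¬ (k : ℕ) ≤ j by omega), mul_zero]
    · rw [if_neg h, zero_mul]

theorem upperToeplitz_C (n : ℕ) (c : R) :
    upperToeplitz n (C c) = Matrix.diagonal fun _ => c := by
  ext i j
  simp only [upperToeplitz, Matrix.of_apply, coeff_C, Matrix.diagonal_apply, Fin.ext_iff]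
  split_ifs <;> first | rfl | omega

theorem upperToeplitz_one (n : ℕ) : upperToeplitz n (1 : PowerSeries R) = 1 := by
  rw [← map_one C, upperToeplitz_C, Matrix.diagonal_one]

theorem upperToeplitz_add (n : ℕ) (F G : PowerSeries R) :
    upperToeplitz n (F + G) = upperToeplitz n F + upperToeplitz n G := by
  ext i j
  simp only [upperToeplitz, Matrix.of_apply, Matrix.add_apply, map_add]
  split_ifs <;> simp

theorem upperToeplitz_neg (n : ℕ) (F : PowerSeries R) :
    upperToeplitz n (-F) = -upperToeplitz n F := by
  ext i j
  simp only [upperToeplitz, Matrix.of_apply, Matrix.neg_apply, map_neg]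
  split_ifs <;> simp

theorem sum_lower_mul {n : ℕ} (f g : ℕ → R) (i : Fin n) :
    ∑ a : Fin n, (if (a : ℕ) ≤ i then f (i - a) else 0) * g a =
      ∑ p ∈ Finset.range (i + 1), f p * g (i - p) := by
  simp only [ite_mul, zero_mul]
  rw [sum_fin_ite_le i.isLt (fun a => f (i - a) * g a), ← Finset.sum_range_reflect]
  refine Finset.sum_congr rfl fun p hp => ?_
  have := Finset.mem_range.1 hp
  rw [show (i : ℕ) + 1 - 1 - p = i - p by omega, show (i : ℕ) - (i - p) = p by omega]

theorem sum_mul_upper {n : ℕ} (f g : ℕ → R) (k : Fin n) :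
    ∑ b : Fin n, f b * (if (b : ℕ) ≤ k then g (k - b) else 0) =
      ∑ p ∈ Finset.range (k + 1), f p * g (k - p) := by
  simp only [mul_ite, mul_zero]
  rw [sum_fin_ite_le k.isLt (fun b => f b * g (k - b))]

/-- The coefficient of degree `i + k + 1` in `T * S = 1` vanishes. Its terms with `p ≤ i` form the
left entry, the others minus the right one. -/
theorem lowerToeplitz_mul_hankelMat_one {S T : PowerSeries R} (h : T * S = 1) (n : ℕ) :
    lowerToeplitz n T * hankelMat n (fun j => coeff j S) 1 =
      -hankelMat n (fun j => coeff j T) 1 * upperToeplitz n S := by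
  ext i k
  simp only [Matrix.mul_apply, lowerToeplitz, upperToeplitz, hankelMat, Matrix.of_apply,
    Matrix.neg_apply]
  rw [sum_lower_mul (fun j => coeff j T) (fun a => coeff (a + k + 1) S),
    sum_mul_upper (fun b => -coeff (i + b + 1) T) (fun j => coeff j S)]
  have hc := congrArg (coeff ((i : ℕ) + k + 1)) h
  rw [coeff_mul_eq_sum_range, coeff_one, if_neg (by omega),
    show (i : ℕ) + k + 1 + 1 = (i + 1) + (k + 1) by omega, Finset.sum_range_add] at hc
  simp only [neg_mul, Finset.sum_neg_distrib]
  rw [eq_neg_iff_add_eq_zero, ← hc]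
  congr 1
  · refine Finset.sum_congr rfl fun p hp => ?_
    have := Finset.mem_range.1 hp
    rw [show (i : ℕ) - p + k + 1 = i + k + 1 - p by omega]
  · refine Finset.sum_congr rfl fun p hp => ?_
    rw [show (i : ℕ) + p + 1 = i + 1 + p by omega,
      show (i : ℕ) + k + 1 - (i + 1 + p) = k - p by omega]

/-- The same splitting in degree `i + k`. The term `p = i` already lies on the left, which forces
the zeros in column `0` below the corner. -/
theorem lowerToeplitz_mul_hankelMat_zero {S T : PowerSeries R} (h : T * S = 1) (n : ℕ) :
    lowerToeplitz n T * hankelMat n (fun j => coeff j S) 0 =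
      borderedHankel n (fun j => coeff j T) * upperToeplitz n S := by
  ext i k
  simp only [Matrix.mul_apply, lowerToeplitz, upperToeplitz, hankelMat, Matrix.of_apply,
    borderedHankel]
  rw [sum_lower_mul (fun j => coeff j T) (fun a => coeff (a + k + 0) S),
    sum_mul_upper (fun b => if (i : ℕ) = 0 then (if b = 0 then coeff 0 T else 0)
      else (if b = 0 then 0 else -coeff (i + b) T)) (fun j => coeff j S),
    Finset.sum_range_succ' _ (k : ℕ)]
  by_cases hi : (i : ℕ) = 0
  -- In row `0` the degree may be `0`, where the coefficient of `1` does not vanish; here both sides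
  -- are `t_0 * s_k`.
  · simp [hi]
  have hc := congrArg (coeff ((i : ℕ) + k)) h
  rw [coeff_mul_eq_sum_range, coeff_one, if_neg (by omega),
    show (i : ℕ) + k + 1 = (i + 1) + k by omega, Finset.sum_range_add] at hc
  simp only [if_neg hi, Nat.succ_ne_zero, if_true, if_false, zero_mul, add_zero, neg_mul,
    Finset.sum_neg_distrib]
  rw [eq_neg_iff_add_eq_zero, ← hc]
  congr 1
  · refine Finset.sum_congr rfl fun p hp => ?_
    have := Finset.mem_range.1 hp
    rw [show (i : ℕ) - p + k = i + k - p by omega]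
  · refine Finset.sum_congr rfl fun p hp => ?_
    rw [show (i : ℕ) + (p + 1) = i + 1 + p by omega,
      show (i : ℕ) + k - (i + 1 + p) = k - (p + 1) by omega]

/-! ### Series with star operation -/

variable [StarRing R]

/-- The coefficientwise adjoint of a power series. -/
def starSeries (F : PowerSeries R) : PowerSeries R := PowerSeries.mk fun n => star (coeff n F)

@[simp]
theorem coeff_starSeries (F : PowerSeries R) (n : ℕ) :
    coeff n (starSeries F) = star (coeff n F) := coeff_mk _ _

theorem starSeries_mul (F G : PowerSeries R) :
    starSeries (F * G) = starSeries G * starSeries F := by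
  ext n
  rw [coeff_starSeries, coeff_mul, coeff_mul, star_sum, ← Finset.Nat.sum_antidiagonal_swap]
  simp

theorem starSeries_one : starSeries (1 : PowerSeries R) = 1 := by
  ext n
  rw [coeff_starSeries, coeff_one]
  split_ifs <;> simp

theorem conjTranspose_upperToeplitz (n : ℕ) (F : PowerSeries R) :
    (upperToeplitz n F)ᴴ = lowerToeplitz n (starSeries F) := by
  ext i j
  simp only [upperToeplitz, lowerToeplitz, Matrix.conjTranspose_apply, Matrix.of_apply,
    coeff_starSeries]
  split_ifs <;> simp

end Toeplitz

/-! ### Block matrices as matrices over the ring of `q × q` matrices -/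

section Blocks

variable {q : ℕ}

/-- Flattening of a matrix of `q × q` blocks, as a ring isomorphism. -/
abbrev flatten (q n : ℕ) : Matrix (Fin n) (Fin n) (Matrix (Fin q) (Fin q) ℂ) ≃+*
    Matrix (Fin n × Fin q) (Fin n × Fin q) ℂ :=
  Matrix.compRingEquiv (Fin n) (Fin q) ℂ

theorem flatten_apply {n : ℕ} (A : Matrix (Fin n) (Fin n) (Matrix (Fin q) (Fin q) ℂ))
    (a b : Fin n × Fin q) : flatten q n A a b = A a.1 b.1 a.2 b.2 := rfl

theorem flatten_conjTranspose {n : ℕ} (A : Matrix (Fin n) (Fin n) (Matrix (Fin q) (Fin q) ℂ)) :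
    flatten q n Aᴴ = (flatten q n A)ᴴ := rfl

/-- The block column with given blocks. -/
def blockCol {n : ℕ} (w : Fin n → Matrix (Fin q) (Fin q) ℂ) : Matrix (Fin n × Fin q) (Fin q) ℂ :=
  Matrix.of fun a j => w a.1 a.2 j

theorem blockCol_injective {n : ℕ} :
    Function.Injective (blockCol : (Fin n → Matrix (Fin q) (Fin q) ℂ) → _) := by
  intro w w' h
  funext i
  ext a j
  exact congrFun (congrFun h (i, a)) j

theorem blockCol_surjective {n : ℕ} :
    Function.Surjective (blockCol : (Fin n → Matrix (Fin q) (Fin q) ℂ) → _) :=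
  fun W => ⟨fun i => Matrix.of fun a j => W (i, a) j, rfl⟩

theorem flatten_mul_blockCol {n : ℕ} (A : Matrix (Fin n) (Fin n) (Matrix (Fin q) (Fin q) ℂ))
    (w : Fin n → Matrix (Fin q) (Fin q) ℂ) :
    flatten q n A * blockCol w = blockCol (A *ᵥ w) := by
  ext ⟨i, a⟩ j
  simp only [Matrix.mul_apply, blockCol, Matrix.of_apply, flatten_apply, Fintype.sum_prod_type,
    Matrix.mulVec, dotProduct, Matrix.sum_apply]

theorem blockCol_mul {n : ℕ} (w : Fin n → Matrix (Fin q) (Fin q) ℂ)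
    (c : Matrix (Fin q) (Fin q) ℂ) : blockCol w * c = blockCol fun i => w i * c := by
  ext ⟨i, a⟩ j
  simp only [Matrix.mul_apply, blockCol, Matrix.of_apply]

theorem colV_eq_blockCol (n : ℕ) :
    colV q n = blockCol (Pi.single (0 : Fin (n + 1)) (1 : Matrix (Fin q) (Fin q) ℂ)) := by
  ext ⟨i, a⟩ j
  by_cases h : i = 0
  · subst h; simp [colV, blockCol]
  · simp [colV, blockCol, h]

theorem colV_mul (n : ℕ) (c : Matrix (Fin q) (Fin q) ℂ) :
    colV q n * c = blockCol (Pi.single (0 : Fin (n + 1)) c) := by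
  rw [colV_eq_blockCol, blockCol_mul]
  congr 1
  funext i
  by_cases h : i = 0
  · subst h; simp
  · simp [h]

theorem conjTranspose_colV_mul_blockCol {n : ℕ} (w : Fin (n + 1) → Matrix (Fin q) (Fin q) ℂ) :
    (colV q n)ᴴ * blockCol w = w 0 := by
  ext a j
  simp [Matrix.mul_apply, colV, blockCol, Fintype.sum_prod_type, Matrix.one_apply, apply_ite,
    Finset.sum_ite_irrel]

theorem conjTranspose_colV_mul_flatten_mul_blockCol {n : ℕ}
    (A : Matrix (Fin (n + 1)) (Fin (n + 1)) (Matrix (Fin q) (Fin q) ℂ))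
    (w : Fin (n + 1) → Matrix (Fin q) (Fin q) ℂ) :
    (colV q n)ᴴ * (flatten q (n + 1) A * blockCol w) = (A *ᵥ w) 0 := by
  rw [flatten_mul_blockCol, conjTranspose_colV_mul_blockCol]

theorem colY_eq_blockCol (s : ℕ → Matrix (Fin q) (Fin q) ℂ) (n : ℕ) :
    colY s n = blockCol fun i : Fin (n + 1) => s i := rfl

theorem hankelH_eq_flatten (s : ℕ → Matrix (Fin q) (Fin q) ℂ) (n : ℕ) :
    hankelH s n = flatten q (n + 1) (hankelMat (n + 1) s 0) := rfl

theorem hankelK_eq_flatten (s : ℕ → Matrix (Fin q) (Fin q) ℂ) (n : ℕ) :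
    hankelK s n = flatten q (n + 1) (hankelMat (n + 1) s 1) := rfl

/-! ### The factors of Dyukarev's matrices as Toeplitz matrices -/

/-- The series `∑ z ^ k X ^ k`. -/
def geomSeries (q : ℕ) (z : ℂ) : PowerSeries (Matrix (Fin q) (Fin q) ℂ) :=
  PowerSeries.mk fun k => z ^ k • 1

/-- The coefficients are scalar matrices, so the series is central and all dependence on `z` can be
moved past `S` and `T`. -/
theorem mul_geomSeries_comm (F : PowerSeries (Matrix (Fin q) (Fin q) ℂ)) (z : ℂ) :
    F * geomSeries q z = geomSeries q z * F := by
  ext1 n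
  rw [coeff_mul, coeff_mul, ← Finset.Nat.sum_antidiagonal_swap]
  simp [geomSeries]

theorem geomSeries_eq (z : ℂ) :
    geomSeries q z = 1 + X * (C (z • 1) * geomSeries q z) := by
  ext1 n
  cases n with
  | zero => simp [geomSeries]
  | succ n =>
    rw [map_add, coeff_succ_X_mul, coeff_C_mul, coeff_one, if_neg (Nat.succ_ne_zero n), zero_add]
    simp [geomSeries, pow_succ, smul_smul]

theorem flatten_upperToeplitz_one_sub (n : ℕ) (z : ℂ) :
    (1 - star z • shiftT q n)ᴴ = flatten q (n + 1) (upperToeplitz (n + 1) (1 - X * C (z • 1))) := by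
  rw [sub_eq_add_neg (1 : PowerSeries _), upperToeplitz_add, upperToeplitz_neg, upperToeplitz_one,
    map_add, map_neg, map_one, ← sub_eq_add_neg, Matrix.conjTranspose_sub,
    Matrix.conjTranspose_one, Matrix.conjTranspose_smul, star_star]
  congr 1
  ext ⟨i, a⟩ ⟨j, b⟩
  rw [flatten_apply]
  simp only [Matrix.smul_apply, Matrix.conjTranspose_apply, shiftT, Matrix.of_apply,
    upperToeplitz]
  by_cases h : (j : ℕ) = i + 1
  · rw [if_pos h, if_pos (by omega), h, show (i : ℕ) + 1 - i = 0 + 1 by omega, coeff_succ_X_mul,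
      coeff_zero_C]
    by_cases hab : a = b
    · subst hab; simp
    · simp [hab, Ne.symm hab]
  · rw [if_neg h]
    split_ifs with h1
    · rcases Nat.eq_zero_or_pos ((j : ℕ) - i) with h2 | h2
      · rw [h2, coeff_zero_X_mul]; simp
      · obtain ⟨d, hd⟩ := Nat.exists_eq_succ_of_ne_zero h2.ne'
        rw [hd, Nat.succ_eq_add_one, coeff_succ_X_mul, coeff_C, if_neg (by omega)]
        simp
    · simp

/-- The adjoint undoes the conjugation of `z` and makes the shift upper triangular; the truncation
of `1 - zX` is then inverted by that of the geometric series. -/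
theorem conjTranspose_resolventR (n : ℕ) (z : ℂ) :
    (resolventR q n (star z))ᴴ = flatten q (n + 1) (upperToeplitz (n + 1) (geomSeries q z)) := by
  rw [resolventR, Matrix.conjTranspose_nonsing_inv, flatten_upperToeplitz_one_sub]
  apply Matrix.inv_eq_right_inv
  rw [← map_mul, upperToeplitz_mul]
  have h : (1 - X * C (z • (1 : Matrix (Fin q) (Fin q) ℂ))) * geomSeries q z = 1 := by
    rw [sub_mul, one_mul, mul_assoc, sub_eq_iff_eq_add]
    exact geomSeries_eq z
  rw [h, upperToeplitz_one, map_one]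

/-- As the `s_j` are self-adjoint, the adjoint column is the first block row of a Toeplitz matrix,
which merges with the one of the resolvent. -/
theorem conjTranspose_colY {s : ℕ → Matrix (Fin q) (Fin q) ℂ} (hs : ∀ j, (s j)ᴴ = s j) (n : ℕ) :
    (colY s n)ᴴ =
      (colV q n)ᴴ * flatten q (n + 1) (upperToeplitz (n + 1) (PowerSeries.mk s)) := by
  ext a ⟨k, b⟩
  have h : ∀ j, star (s j b a) = s j a b := fun j => congrFun (congrFun (hs j) a) b
  simp [Matrix.mul_apply, Fintype.sum_prod_type, colV, colY, upperToeplitz,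
    Matrix.one_apply, apply_ite, Finset.sum_ite_irrel]
  exact h _

theorem conjTranspose_colU {s : ℕ → Matrix (Fin q) (Fin q) ℂ} (hs : ∀ j, (s j)ᴴ = s j) (n : ℕ) :
    (colU s n)ᴴ =
      -((colV q n)ᴴ * flatten q (n + 1) (upperToeplitz (n + 1) (X * PowerSeries.mk s))) := by
  ext a ⟨k, b⟩
  have h : ∀ j, star (s j b a) = s j a b := fun j => congrFun (congrFun (hs j) a) b
  simp only [Matrix.mul_apply, Fintype.sum_prod_type, colV, colU, flatten_apply, upperToeplitz,
    Matrix.neg_apply, Matrix.conjTranspose_apply, Matrix.of_apply]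
  refine Fin.cases ?_ (fun i => ?_) k
  · rw [if_pos rfl, star_zero, eq_comm, neg_eq_zero]
    refine Finset.sum_eq_zero fun x _ => Finset.sum_eq_zero fun y _ => ?_
    rw [Fin.val_zero, Nat.zero_sub, coeff_zero_X_mul]
    split_ifs <;> simp
  · have h' : coeff ((i : ℕ) + 1) (X * PowerSeries.mk s) = s i := by
      rw [coeff_succ_X_mul, coeff_mk]
    simp [Matrix.one_apply, apply_ite, Finset.sum_ite_irrel, h']
    exact h _

theorem inv_mul_eq_of_posDef {m : Type*} [Fintype m] [DecidableEq m] {p : Type*}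
    {A : Matrix m m ℂ}
    (hA : A.PosDef) {B D : Matrix m p ℂ} (h : A * B = D) : A⁻¹ * D = B := by
  rw [← h, ← Matrix.mul_assoc,
    Matrix.nonsing_inv_mul A ((Matrix.isUnit_iff_isUnit_det A).1 hA.isUnit),
    Matrix.one_mul]

/-! ### Dyukarev's polynomials evaluated on solutions of Hankel systems -/

variable {s : ℕ → Matrix (Fin q) (Fin q) ℂ}

/-- Trades the inverse Hankel matrix for a known solution `w`. The right factor `c` is kept free
because the solutions found later have right-hand side `s_0` rather than `1`. -/
theorem alphaPoly_mul (hs : ∀ j, (s j)ᴴ = s j) {n : ℕ} (hH : (hankelH s n).PosDef)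
    {w : Fin (n + 1) → Matrix (Fin q) (Fin q) ℂ} {c : Matrix (Fin q) (Fin q) ℂ}
    (hw : hankelMat (n + 1) s 0 *ᵥ w = Pi.single 0 c) (z : ℂ) :
    alphaPoly s n z * c =
      c + z • (upperToeplitz (n + 1) (X * PowerSeries.mk s * geomSeries q z) *ᵥ w) 0 := by
  have h : (hankelH s n)⁻¹ * (colV q n * c) = blockCol w :=
    inv_mul_eq_of_posDef hH (by rw [hankelH_eq_flatten, flatten_mul_blockCol, hw, colV_mul])
  rw [alphaPoly, sub_mul, one_mul, Matrix.smul_mul, conjTranspose_colU hs,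
    conjTranspose_resolventR]
  simp only [Matrix.mul_assoc, Matrix.neg_mul]
  rw [h, ← Matrix.mul_assoc (flatten q (n + 1) _), ← map_mul, upperToeplitz_mul,
    conjTranspose_colV_mul_flatten_mul_blockCol, smul_neg, sub_neg_eq_add]

theorem gammaPoly_mul {n : ℕ} (hH : (hankelH s n).PosDef)
    {w : Fin (n + 1) → Matrix (Fin q) (Fin q) ℂ} {c : Matrix (Fin q) (Fin q) ℂ}
    (hw : hankelMat (n + 1) s 0 *ᵥ w = Pi.single 0 c) (z : ℂ) :
    gammaPoly s n z * c = -(z • (upperToeplitz (n + 1) (geomSeries q z) *ᵥ w) 0) := by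
  have h : (hankelH s n)⁻¹ * (colV q n * c) = blockCol w :=
    inv_mul_eq_of_posDef hH (by rw [hankelH_eq_flatten, flatten_mul_blockCol, hw, colV_mul])
  rw [gammaPoly, neg_mul, Matrix.smul_mul, conjTranspose_resolventR]
  simp only [Matrix.mul_assoc]
  rw [h, conjTranspose_colV_mul_flatten_mul_blockCol]

theorem inv_hankelK_mul_colY {n : ℕ} (hK : (hankelK s n).PosDef)
    {w : Fin (n + 1) → Matrix (Fin q) (Fin q) ℂ}
    (hw : hankelMat (n + 1) s 1 *ᵥ w = fun i : Fin (n + 1) => s i) :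
    (hankelK s n)⁻¹ * colY s n = blockCol w :=
  inv_mul_eq_of_posDef hK (by
    rw [hankelK_eq_flatten, flatten_mul_blockCol, hw, colY_eq_blockCol])

theorem exists_hankelMat_one_mulVec {n : ℕ} (hK : (hankelK s n).PosDef) :
    ∃ w : Fin (n + 1) → Matrix (Fin q) (Fin q) ℂ,
      hankelMat (n + 1) s 1 *ᵥ w = fun i : Fin (n + 1) => s i := by
  obtain ⟨w, hw⟩ := blockCol_surjective ((hankelK s n)⁻¹ * colY s n)
  refine ⟨w, blockCol_injective ?_⟩
  rw [← flatten_mul_blockCol, hw, ← hankelK_eq_flatten, ← Matrix.mul_assoc,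
    Matrix.mul_nonsing_inv _ ((Matrix.isUnit_iff_isUnit_det _).1 hK.isUnit), Matrix.one_mul]
  rfl

theorem betaPoly_succ (hs : ∀ j, (s j)ᴴ = s j) {n : ℕ} (hK : (hankelK s n).PosDef)
    {w : Fin (n + 1) → Matrix (Fin q) (Fin q) ℂ}
    (hw : hankelMat (n + 1) s 1 *ᵥ w = fun i : Fin (n + 1) => s i) (z : ℂ) :
    betaPoly s (n + 1) z =
      (upperToeplitz (n + 1) (PowerSeries.mk s * geomSeries q z) *ᵥ w) 0 := by
  rw [betaPoly, conjTranspose_colY hs, conjTranspose_resolventR]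
  simp only [Matrix.mul_assoc]
  rw [inv_hankelK_mul_colY hK hw, ← Matrix.mul_assoc (flatten q (n + 1) _), ← map_mul,
    upperToeplitz_mul, conjTranspose_colV_mul_flatten_mul_blockCol]

theorem deltaPoly_succ {n : ℕ} (hK : (hankelK s n).PosDef)
    {w : Fin (n + 1) → Matrix (Fin q) (Fin q) ℂ}
    (hw : hankelMat (n + 1) s 1 *ᵥ w = fun i : Fin (n + 1) => s i) (z : ℂ) :
    deltaPoly s (n + 1) z = 1 - z • (upperToeplitz (n + 1) (geomSeries q z) *ᵥ w) 0 := by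
  rw [deltaPoly, conjTranspose_resolventR]
  simp only [Matrix.mul_assoc]
  rw [inv_hankelK_mul_colY hK hw, conjTranspose_colV_mul_flatten_mul_blockCol]

end Blocks

/-! ### The reciprocal sequence and the first transform -/

section Transform

variable {q : ℕ} {s : ℕ → Matrix (Fin q) (Fin q) ℂ}

theorem moorePenrose_eq_inv {A : Matrix (Fin q) (Fin q) ℂ} (hA : IsUnit A.det) :
    moorePenrose A = A⁻¹ :=
  (moorePenrose_spec A).unique
    ⟨by rw [Matrix.mul_nonsing_inv A hA, one_mul], by rw [Matrix.nonsing_inv_mul A hA, one_mul],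
      by rw [Matrix.mul_nonsing_inv A hA, Matrix.conjTranspose_one],
      by rw [Matrix.nonsing_inv_mul A hA, Matrix.conjTranspose_one]⟩

theorem IsStieltjesPosDef.conjTranspose_eq (hs : IsStieltjesPosDef s) (j : ℕ) : (s j)ᴴ = s j := by
  ext a b
  -- The blocks `(j, 0)` and `(0, j)` of `H_j` are both `s j`.
  have h := congrFun (congrFun (hs j).1.isHermitian.eq ((Fin.last j), a)) ((0 : Fin (j + 1)), b)
  simpa [hankelH] using h

theorem IsStieltjesPosDef.isUnit_det (hs : IsStieltjesPosDef s) : IsUnit (s 0).det := by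
  have h := (hs 0).1.submatrix (e := fun a : Fin q => ((0 : Fin 1), a))
    (fun a b hab => (Prod.ext_iff.1 hab).2)
  have e : (hankelH s 0).submatrix (fun a : Fin q => ((0 : Fin 1), a))
      (fun a : Fin q => ((0 : Fin 1), a)) = s 0 := rfl
  rw [e] at h
  exact (Matrix.isUnit_iff_isUnit_det _).1 h.isUnit

theorem reciprocalSeq_zero (h0 : IsUnit (s 0).det) : reciprocalSeq s 0 = (s 0)⁻¹ := by
  rw [reciprocalSeq, moorePenrose_eq_inv h0]

/-- After multiplication by `s_0`, the recursion for `s_j^♯` says exactly that the coefficient of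
degree `j` in the product vanishes. -/
theorem mk_mul_mk_reciprocalSeq (h0 : IsUnit (s 0).det) :
    PowerSeries.mk s * PowerSeries.mk (reciprocalSeq s) = 1 := by
  ext1 n
  cases n with
  | zero =>
    rw [coeff_mul_eq_sum_range, Finset.sum_range_one, coeff_mk, coeff_mk,
      reciprocalSeq_zero h0, coeff_zero_one, Matrix.mul_nonsing_inv _ h0]
  | succ n =>
    rw [coeff_one, if_neg (Nat.succ_ne_zero n), coeff_mul, ← Finset.Nat.sum_antidiagonal_swap,
      Finset.Nat.sum_antidiagonal_eq_sum_range_succ_mk, Finset.sum_range_succ]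
    simp only [Prod.swap_prod_mk, coeff_mk, Nat.sub_self]
    rw [reciprocalSeq, moorePenrose_eq_inv h0, neg_mul, mul_neg, ← mul_assoc,
      Matrix.mul_nonsing_inv _ h0, one_mul,
      Finset.sum_range fun l => s (n + 1 - l) * reciprocalSeq s l, add_neg_cancel]

theorem starSeries_mk (hs : ∀ j, (s j)ᴴ = s j) :
    starSeries (PowerSeries.mk s) = PowerSeries.mk s := by
  ext1 n
  rw [coeff_starSeries, coeff_mk, Matrix.star_eq_conjTranspose, hs]

/-- The recursion only gives a right inverse of `S`. Adjoints turn it into a left inverse, and the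
agreement of the two makes `T` self-adjoint and two-sided. -/
theorem starSeries_mk_reciprocalSeq_mul (hs : ∀ j, (s j)ᴴ = s j) (h0 : IsUnit (s 0).det) :
    starSeries (PowerSeries.mk (reciprocalSeq s)) * PowerSeries.mk s = 1 := by
  have h := congrArg starSeries (mk_mul_mk_reciprocalSeq h0)
  rwa [starSeries_mul, starSeries_mk hs, starSeries_one] at h

theorem starSeries_mk_reciprocalSeq (hs : ∀ j, (s j)ᴴ = s j) (h0 : IsUnit (s 0).det) :
    starSeries (PowerSeries.mk (reciprocalSeq s)) = PowerSeries.mk (reciprocalSeq s) :=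
  left_inv_eq_right_inv (starSeries_mk_reciprocalSeq_mul hs h0) (mk_mul_mk_reciprocalSeq h0)

theorem mk_reciprocalSeq_mul_mk (hs : ∀ j, (s j)ᴴ = s j) (h0 : IsUnit (s 0).det) :
    PowerSeries.mk (reciprocalSeq s) * PowerSeries.mk s = 1 := by
  rw [← starSeries_mk_reciprocalSeq_mul hs h0, starSeries_mk_reciprocalSeq hs h0]

theorem C_mul_C_inv {A : Matrix (Fin q) (Fin q) ℂ} (hA : IsUnit A.det) :
    (C A * C A⁻¹ : PowerSeries (Matrix (Fin q) (Fin q) ℂ)) = 1 := by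
  rw [← map_mul, Matrix.mul_nonsing_inv _ hA, map_one]

theorem C_inv_mul_C {A : Matrix (Fin q) (Fin q) ℂ} (hA : IsUnit A.det) :
    (C A⁻¹ * C A : PowerSeries (Matrix (Fin q) (Fin q) ℂ)) = 1 := by
  rw [← map_mul, Matrix.nonsing_inv_mul _ hA, map_one]

/-- The constant terms cancel because `T` starts with `s_0⁻¹`. In this form the transform enters the
series identities of the recursion. -/
theorem X_mul_mk_firstTransform (h0 : IsUnit (s 0).det) :
    X * PowerSeries.mk (firstTransform s) =
      C (s 0) - C (s 0) * PowerSeries.mk (reciprocalSeq s) * C (s 0) := by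
  ext1 n
  cases n with
  | zero =>
    rw [coeff_zero_X_mul, map_sub, coeff_mul_C, coeff_C_mul, coeff_mk, coeff_zero_C,
      reciprocalSeq_zero h0, Matrix.mul_nonsing_inv _ h0, one_mul, sub_self]
  | succ n =>
    rw [coeff_succ_X_mul, map_sub, coeff_mul_C, coeff_C_mul, coeff_mk, coeff_mk, coeff_C,
      if_neg (Nat.succ_ne_zero n), zero_sub, firstTransform, neg_mul, neg_mul]

/-! ### Congruences and positivity of the transform -/

theorem conjTranspose_diagonal_const {n : ℕ} {A : Matrix (Fin q) (Fin q) ℂ} (hA : Aᴴ = A) :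
    (Matrix.diagonal fun _ : Fin n => A)ᴴ = Matrix.diagonal fun _ => A := by
  rw [Matrix.diagonal_conjTranspose]
  congr 1
  funext i
  exact hA

theorem hankelMat_firstTransform (s : ℕ → Matrix (Fin q) (Fin q) ℂ) (n k : ℕ) :
    hankelMat n (firstTransform s) k = (Matrix.diagonal fun _ => s 0) *
      -hankelMat n (reciprocalSeq s) (k + 1) * Matrix.diagonal fun _ => s 0 := by
  ext1 i j
  rw [Matrix.mul_diagonal, Matrix.diagonal_mul, Matrix.neg_apply]
  simp only [hankelMat, Matrix.of_apply, firstTransform, neg_mul, mul_neg, add_assoc]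

theorem lowerToeplitz_reciprocalSeq (hs : ∀ j, (s j)ᴴ = s j) (h0 : IsUnit (s 0).det) (n : ℕ) :
    lowerToeplitz n (PowerSeries.mk (reciprocalSeq s)) =
      (upperToeplitz n (PowerSeries.mk (reciprocalSeq s)))ᴴ := by
  rw [conjTranspose_upperToeplitz, starSeries_mk_reciprocalSeq hs h0]

theorem isUnit_lowerToeplitz_reciprocalSeq (hs : ∀ j, (s j)ᴴ = s j) (h0 : IsUnit (s 0).det)
    (n : ℕ) : IsUnit (lowerToeplitz n (PowerSeries.mk (reciprocalSeq s))) := by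
  rw [lowerToeplitz_reciprocalSeq hs h0, ← Matrix.star_eq_conjTranspose, isUnit_star]
  exact ⟨⟨upperToeplitz n (PowerSeries.mk (reciprocalSeq s)),
    upperToeplitz n (PowerSeries.mk s),
    by rw [upperToeplitz_mul, mk_reciprocalSeq_mul_mk hs h0, upperToeplitz_one],
    by rw [upperToeplitz_mul, mk_mul_mk_reciprocalSeq h0, upperToeplitz_one]⟩, rfl⟩

theorem isUnit_diagonal_const {A : Matrix (Fin q) (Fin q) ℂ} (hA : IsUnit A.det) (n : ℕ) :
    IsUnit (Matrix.diagonal fun _ : Fin n => A) := by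
  rw [← upperToeplitz_C]
  exact ⟨⟨upperToeplitz n (C A), upperToeplitz n (C A⁻¹),
    by rw [upperToeplitz_mul, C_mul_C_inv hA, upperToeplitz_one],
    by rw [upperToeplitz_mul, C_inv_mul_C hA, upperToeplitz_one]⟩, rfl⟩

theorem lowerToeplitz_mul_hankelMat_one' (hs : ∀ j, (s j)ᴴ = s j) (h0 : IsUnit (s 0).det)
    (n : ℕ) :
    lowerToeplitz n (PowerSeries.mk (reciprocalSeq s)) * hankelMat n s 1 =
      -hankelMat n (reciprocalSeq s) 1 * upperToeplitz n (PowerSeries.mk s) := by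
  simpa only [coeff_mk] using lowerToeplitz_mul_hankelMat_one (mk_reciprocalSeq_mul_mk hs h0) n

theorem lowerToeplitz_mul_hankelMat_zero' (hs : ∀ j, (s j)ᴴ = s j) (h0 : IsUnit (s 0).det)
    (n : ℕ) :
    lowerToeplitz n (PowerSeries.mk (reciprocalSeq s)) * hankelMat n s 0 =
      borderedHankel n (reciprocalSeq s) * upperToeplitz n (PowerSeries.mk s) := by
  simpa only [coeff_mk] using lowerToeplitz_mul_hankelMat_zero (mk_reciprocalSeq_mul_mk hs h0) n

theorem posDef_flatten_congr {n : ℕ} {A B : Matrix (Fin n) (Fin n) (Matrix (Fin q) (Fin q) ℂ)}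
    (hA : (flatten q n A).PosDef) (hB : IsUnit B) : (flatten q n (B * A * Bᴴ)).PosDef := by
  rw [map_mul, map_mul, flatten_conjTranspose]
  exact hA.mul_mul_conjTranspose_same
    (Matrix.vecMul_injective_iff_isUnit.2 (hB.map (flatten q n)))

/-- Let `B` be the lower Toeplitz matrix of `T` multiplied on the left by the block diagonal of
`s_0`. Then `H_n(s') = B K_n(s) Bᴴ`, while `K_n(s')` is a principal submatrix of `B H_{n+1}(s) Bᴴ`.
-/
theorem IsStieltjesPosDef.firstTransform (hs : IsStieltjesPosDef s) :
    IsStieltjesPosDef (firstTransform s) := by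
  have hh := hs.conjTranspose_eq
  have h0 := hs.isUnit_det
  have hU : ∀ n, upperToeplitz n (PowerSeries.mk s) *
      upperToeplitz n (PowerSeries.mk (reciprocalSeq s)) = 1 := fun n => by
    rw [upperToeplitz_mul, mk_mul_mk_reciprocalSeq h0, upperToeplitz_one]
  have hB : ∀ n, IsUnit ((Matrix.diagonal fun _ : Fin n => s 0) *
      lowerToeplitz n (PowerSeries.mk (reciprocalSeq s))) := fun n =>
    (isUnit_diagonal_const h0 n).mul (isUnit_lowerToeplitz_reciprocalSeq hh h0 n)
  have hBH : ∀ n, ((Matrix.diagonal fun _ : Fin n => s 0) *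
      lowerToeplitz n (PowerSeries.mk (reciprocalSeq s)))ᴴ =
        upperToeplitz n (PowerSeries.mk (reciprocalSeq s)) * Matrix.diagonal fun _ => s 0 :=
    fun n => by
      rw [Matrix.conjTranspose_mul, conjTranspose_diagonal_const (hh 0),
        lowerToeplitz_reciprocalSeq hh h0, Matrix.conjTranspose_conjTranspose]
  intro n
  constructor
  · have h := posDef_flatten_congr (A := hankelMat (n + 1) s 1) (hs n).2 (hB (n + 1))
    rw [hBH, mul_assoc (Matrix.diagonal _), lowerToeplitz_mul_hankelMat_one' hh h0] at h
    rw [hankelH_eq_flatten, hankelMat_firstTransform]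
    convert h using 2
    simp only [mul_assoc]
    rw [← mul_assoc (upperToeplitz _ _), hU, one_mul]
  · have h := posDef_flatten_congr (A := hankelMat (n + 2) s 0) (hs (n + 1)).1 (hB (n + 2))
    -- Deleting block row and column `0` removes the border.
    have e : (flatten q (n + 2) ((Matrix.diagonal fun _ => s 0) *
        borderedHankel (n + 2) (reciprocalSeq s) * Matrix.diagonal fun _ => s 0)).submatrix
          (Prod.map Fin.succ id) (Prod.map Fin.succ id) =
        hankelK (StieltjesResolvent.firstTransform s) n := by
      rw [hankelK_eq_flatten, hankelMat_firstTransform]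
      ext ⟨i, a⟩ ⟨j, b⟩
      simp only [Matrix.submatrix_apply, flatten_apply, Prod.map, id, Matrix.mul_diagonal,
        Matrix.diagonal_mul, Matrix.neg_apply, borderedHankel, hankelMat, Matrix.of_apply,
        Fin.val_succ, if_neg (Nat.succ_ne_zero _)]
      rw [show (i : ℕ) + 1 + (j + 1) = i + j + (1 + 1) by omega]
    rw [← e]
    refine Matrix.PosDef.submatrix ?_ ((Fin.succ_injective _).prodMap Function.injective_id)
    rw [hBH, mul_assoc (Matrix.diagonal _), lowerToeplitz_mul_hankelMat_zero' hh h0] at h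
    convert h using 2
    simp only [mul_assoc]
    rw [← mul_assoc (upperToeplitz _ _), hU, one_mul]

theorem IsStieltjesPosDef.transform (hs : IsStieltjesPosDef s) (k : ℕ) :
    IsStieltjesPosDef (transform s k) := by
  induction k with
  | zero => exact hs
  | succ k ih => exact ih.firstTransform

end Transform

/-! ### The recursion for Dyukarev's matrices -/

section Recursion

variable {q : ℕ} {s : ℕ → Matrix (Fin q) (Fin q) ℂ}

/-! ### Transport of solutions between the sequence and its transform -/

theorem upperToeplitz_mulVec_mulVec {n : ℕ} (F G : PowerSeries (Matrix (Fin q) (Fin q) ℂ))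
    (w : Fin n → Matrix (Fin q) (Fin q) ℂ) :
    upperToeplitz n F *ᵥ (upperToeplitz n G *ᵥ w) = upperToeplitz n (F * G) *ᵥ w := by
  rw [Matrix.mulVec_mulVec, upperToeplitz_mul]

theorem upperToeplitz_mulVec_zero {n : ℕ} (F : PowerSeries (Matrix (Fin q) (Fin q) ℂ))
    (w : Fin (n + 1) → Matrix (Fin q) (Fin q) ℂ) :
    (upperToeplitz (n + 1) F *ᵥ w) 0 = ∑ k : Fin (n + 1), coeff (k : ℕ) F * w k := by
  simp [Matrix.mulVec, dotProduct, upperToeplitz]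

theorem upperToeplitz_C_mul_mulVec_zero {n : ℕ} (c : Matrix (Fin q) (Fin q) ℂ)
    (F : PowerSeries (Matrix (Fin q) (Fin q) ℂ)) (w : Fin (n + 1) → Matrix (Fin q) (Fin q) ℂ) :
    (upperToeplitz (n + 1) (C c * F) *ᵥ w) 0 = c * (upperToeplitz (n + 1) F *ᵥ w) 0 := by
  simp only [upperToeplitz_mulVec_zero, coeff_C_mul, Finset.mul_sum, mul_assoc]

theorem upperToeplitz_sub_mulVec_zero {n : ℕ} (F G : PowerSeries (Matrix (Fin q) (Fin q) ℂ))
    (w : Fin (n + 1) → Matrix (Fin q) (Fin q) ℂ) :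
    (upperToeplitz (n + 1) (F - G) *ᵥ w) 0 =
      (upperToeplitz (n + 1) F *ᵥ w) 0 - (upperToeplitz (n + 1) G *ᵥ w) 0 := by
  simp only [upperToeplitz_mulVec_zero, map_sub, sub_mul, Finset.sum_sub_distrib]

/-- Splitting off the first block, for a series `F` with `F * c = C a + X * F'`. -/
theorem upperToeplitz_mulVec_cons {n : ℕ} {F F' : PowerSeries (Matrix (Fin q) (Fin q) ℂ)}
    {a c : Matrix (Fin q) (Fin q) ℂ} (h : F * C c = C a + X * F')
    (w : Fin (n + 1) → Matrix (Fin q) (Fin q) ℂ) :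
    (upperToeplitz (n + 2) F *ᵥ Fin.cons c fun i => -(c * w i)) 0 =
      a - (upperToeplitz (n + 1) F' *ᵥ w) 0 := by
  rw [upperToeplitz_mulVec_zero, upperToeplitz_mulVec_zero, Fin.sum_univ_succ, sub_eq_add_neg,
    ← Finset.sum_neg_distrib]
  congr 1
  · have h' := congrArg (coeff 0) h
    rw [coeff_mul_C, map_add, coeff_zero_C, coeff_zero_X_mul, add_zero] at h'
    exact h'
  · refine Finset.sum_congr rfl fun k _ => ?_
    have h' := congrArg (coeff ((k : ℕ) + 1)) h
    rw [coeff_mul_C, map_add, coeff_C, if_neg (Nat.succ_ne_zero _), coeff_succ_X_mul,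
      zero_add] at h'
    rw [Fin.cons_succ, Fin.val_succ, mul_neg, ← mul_assoc, h']

/-- Solution of the Hankel system for the transformed sequence. -/
theorem hankelMat_firstTransform_mulVec (hs : ∀ j, (s j)ᴴ = s j) (h0 : IsUnit (s 0).det)
    {n : ℕ} {w : Fin (n + 1) → Matrix (Fin q) (Fin q) ℂ}
    (hw : hankelMat (n + 1) s 1 *ᵥ w = fun i : Fin (n + 1) => s i) :
    hankelMat (n + 1) (firstTransform s) 0 *ᵥ
      (upperToeplitz (n + 1) (C (s 0)⁻¹ * PowerSeries.mk s) *ᵥ w) = Pi.single 0 (s 0) := by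
  -- The Toeplitz matrix of `T` sends the column of the `s_i` to the first unit column, by `T * S =
  -- 1`.
  have hLy : lowerToeplitz (n + 1) (PowerSeries.mk (reciprocalSeq s)) *ᵥ
      (fun i : Fin (n + 1) => s i) = Pi.single 0 1 := by
    funext i
    simp only [Matrix.mulVec, dotProduct, lowerToeplitz, Matrix.of_apply]
    rw [sum_lower_mul (fun j => coeff j (PowerSeries.mk (reciprocalSeq s))) s]
    have h := congrArg (coeff (i : ℕ)) (mk_reciprocalSeq_mul_mk hs h0)
    simp only [coeff_mul_eq_sum_range, coeff_mk, coeff_one] at h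
    simp only [coeff_mk, h, Pi.single_apply, Fin.ext_iff, Fin.val_zero]
  rw [← upperToeplitz_mul, ← Matrix.mulVec_mulVec, Matrix.mulVec_mulVec, hankelMat_firstTransform,
    ← upperToeplitz_C, mul_assoc (_ * _), upperToeplitz_mul _ (C (s 0)), C_mul_C_inv h0,
    upperToeplitz_one, mul_one, Matrix.mulVec_mulVec, mul_assoc, zero_add,
    ← lowerToeplitz_mul_hankelMat_one' hs h0, ← Matrix.mulVec_mulVec, ← Matrix.mulVec_mulVec, hw,
    hLy, upperToeplitz_C]
  funext i
  rw [Matrix.mulVec_diagonal]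
  by_cases hi : i = 0
  · subst hi; simp
  · simp [hi]

/-- Solution of the Hankel system for `s` from the shifted system of the transformed sequence. -/
theorem hankelMat_succ_mulVec (hs : ∀ j, (s j)ᴴ = s j) (h0 : IsUnit (s 0).det)
    {n : ℕ} {w : Fin (n + 1) → Matrix (Fin q) (Fin q) ℂ}
    (hw : hankelMat (n + 1) (firstTransform s) 1 *ᵥ w =
      fun i : Fin (n + 1) => firstTransform s i) :
    hankelMat (n + 2) s 0 *ᵥ (upperToeplitz (n + 2) (PowerSeries.mk (reciprocalSeq s)) *ᵥ
      Fin.cons (s 0) fun i => -(s 0 * w i)) = Pi.single 0 (s 0) := by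
  obtain ⟨u, hu⟩ := isUnit_lowerToeplitz_reciprocalSeq hs h0 (n + 2)
  -- The system is checked after applying the invertible lower Toeplitz matrix of `T`; the left side
  -- then becomes the bordered Hankel matrix applied to the `Fin.cons` column.
  have hinj : Function.Injective fun v : Fin (n + 2) → Matrix (Fin q) (Fin q) ℂ =>
      lowerToeplitz (n + 2) (PowerSeries.mk (reciprocalSeq s)) *ᵥ v := by
    rw [← hu]
    refine Function.LeftInverse.injective (g := fun v => (↑u⁻¹ : Matrix _ _ _) *ᵥ v) fun v => ?_
    simp only [Matrix.mulVec_mulVec, Units.inv_mul, Matrix.one_mulVec]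
  apply hinj
  simp only
  rw [Matrix.mulVec_mulVec, lowerToeplitz_mul_hankelMat_zero' hs h0, Matrix.mulVec_mulVec,
    mul_assoc, upperToeplitz_mul, mk_mul_mk_reciprocalSeq h0, upperToeplitz_one, mul_one]
  have hsim : ∀ j, s 0 * (reciprocalSeq s (j + 1) * s 0) = -firstTransform s j := fun j => by
    rw [firstTransform, neg_mul, neg_mul, neg_neg, mul_assoc]
  funext i
  have hr : (lowerToeplitz (n + 2) (PowerSeries.mk (reciprocalSeq s)) *ᵥ
      Pi.single 0 (s 0)) i = reciprocalSeq s i * s 0 := by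
    simp only [Matrix.mulVec, dotProduct]
    rw [Fintype.sum_eq_single 0 fun j hj => by rw [Pi.single_eq_of_ne hj, mul_zero]]
    simp [lowerToeplitz]
  rw [hr]
  simp only [Matrix.mulVec, dotProduct]
  rw [Fin.sum_univ_succ, Fin.cons_zero]
  simp only [Fin.cons_succ, borderedHankel, Matrix.of_apply, Fin.val_succ, Fin.val_zero,
    if_neg (Nat.succ_ne_zero _), if_true]
  refine Fin.cases ?_ (fun i => ?_) i
  · simp
  · simp only [Fin.val_succ, if_neg (Nat.succ_ne_zero _), zero_mul, zero_add, neg_mul_neg]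
    have hunit : IsUnit (s 0) := (Matrix.isUnit_iff_isUnit_det _).2 h0
    -- Multiplied by `s_0`, row `i + 1` is, up to sign, equation `i` of `hw`.
    refine hunit.mul_left_cancel ?_
    rw [hsim, ← congrFun hw i, Finset.mul_sum, Matrix.mulVec, dotProduct, ← Finset.sum_neg_distrib]
    refine Finset.sum_congr rfl fun k _ => ?_
    rw [show (i : ℕ) + 1 + (k + 1) = i + k + 1 + 1 by omega, ← mul_assoc (reciprocalSeq s _),
      ← mul_assoc, hsim, neg_mul]
    rfl

/-- If `w` solves the `K_n` system of `s`, its image under the Toeplitz matrix of `s_0⁻¹ S` solves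
the `H_n` system of `s'`. The weight `X S' G` then becomes `S G - s_0 G`, whose two terms produce
`β` and `δ`. -/
theorem alphaPoly_firstTransform_mul (hs : IsStieltjesPosDef s) (n : ℕ) (z : ℂ) :
    alphaPoly (firstTransform s) n z * s 0 =
      s 0 * deltaPoly s (n + 1) z + z • betaPoly s (n + 1) z := by
  have hh := hs.conjTranspose_eq
  have h0 := hs.isUnit_det
  obtain ⟨w, hw⟩ := exists_hankelMat_one_mulVec (hs n).2
  have hF : X * PowerSeries.mk (firstTransform s) * geomSeries q z *
      (C (s 0)⁻¹ * PowerSeries.mk s) =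
      PowerSeries.mk s * geomSeries q z - C (s 0) * geomSeries q z := by
    rw [mul_assoc, ← mul_geomSeries_comm, ← mul_assoc, X_mul_mk_firstTransform h0, ← sub_mul]
    congr 1
    rw [sub_mul, ← mul_assoc, C_mul_C_inv h0, one_mul, ← mul_assoc, mul_assoc (_ * _) (C (s 0)),
      C_mul_C_inv h0, mul_one, mul_assoc, mk_reciprocalSeq_mul_mk hh h0, mul_one]
  rw [alphaPoly_mul hs.firstTransform.conjTranspose_eq (hs.firstTransform n).1
      (hankelMat_firstTransform_mulVec hh h0 hw), upperToeplitz_mulVec_mulVec, hF,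
    upperToeplitz_sub_mulVec_zero, upperToeplitz_C_mul_mulVec_zero,
    betaPoly_succ hh (hs n).2 hw, deltaPoly_succ (hs n).2 hw, mul_sub, mul_one, Matrix.mul_smul,
    smul_sub]
  abel

theorem gammaPoly_firstTransform_mul (hs : IsStieltjesPosDef s) (n : ℕ) (z : ℂ) :
    gammaPoly (firstTransform s) n z * s 0 = -(z • ((s 0)⁻¹ * betaPoly s (n + 1) z)) := by
  have hh := hs.conjTranspose_eq
  have h0 := hs.isUnit_det
  obtain ⟨w, hw⟩ := exists_hankelMat_one_mulVec (hs n).2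
  rw [gammaPoly_mul (hs.firstTransform n).1 (hankelMat_firstTransform_mulVec hh h0 hw),
    upperToeplitz_mulVec_mulVec, ← mul_geomSeries_comm, mul_assoc,
    upperToeplitz_C_mul_mulVec_zero, betaPoly_succ hh (hs n).2 hw]

theorem alphaPoly_mul_eq (hs : IsStieltjesPosDef s) (n : ℕ) (z : ℂ) :
    alphaPoly s n z * s 0 = s 0 * deltaPoly (firstTransform s) n z := by
  cases n with
  | zero =>
    have hu : colU s 0 = 0 := by
      ext ⟨i, a⟩ j
      simp [colU, Fin.fin_one_eq_zero i]
    simp [alphaPoly, deltaPoly, hu]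
  | succ n =>
    have hh := hs.conjTranspose_eq
    have h0 := hs.isUnit_det
    obtain ⟨w, hw⟩ := exists_hankelMat_one_mulVec (hs.firstTransform n).2
    rw [alphaPoly_mul hh (hs (n + 1)).1 (hankelMat_succ_mulVec hh h0 hw),
      upperToeplitz_mulVec_mulVec,
      -- The combined weight is `X S G T = X G`, which has no constant term.
      upperToeplitz_mulVec_cons (a := 0) (F' := C (s 0) * geomSeries q z),
      upperToeplitz_C_mul_mulVec_zero, deltaPoly_succ (hs.firstTransform n).2 hw, zero_sub,
      mul_sub, mul_one, Matrix.mul_smul, smul_neg, sub_eq_add_neg]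
    rw [map_zero, zero_add, mul_assoc X, mul_geomSeries_comm, mul_assoc, mul_assoc, mul_assoc,
      ← mul_assoc (PowerSeries.mk s), mk_mul_mk_reciprocalSeq h0, one_mul, mul_geomSeries_comm]

theorem gammaPoly_zero (hs : IsStieltjesPosDef s) (z : ℂ) :
    gammaPoly s 0 z * s 0 = -(z • 1) := by
  have hw : hankelMat (0 + 1) s 0 *ᵥ Pi.single 0 1 = Pi.single 0 (s 0) := by
    funext i
    rw [Fin.fin_one_eq_zero i]
    simp [hankelMat]
  rw [gammaPoly_mul (hs 0).1 hw, upperToeplitz_mulVec_zero]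
  simp [geomSeries]

theorem gammaPoly_mul_eq (hs : IsStieltjesPosDef s) (n : ℕ) (z : ℂ) :
    gammaPoly s n z * s 0 = -(z • (deltaPoly (firstTransform s) n z +
      (s 0)⁻¹ * betaPoly (firstTransform s) n z)) := by
  cases n with
  | zero => rw [gammaPoly_zero hs, deltaPoly, betaPoly, mul_zero, add_zero]
  | succ n =>
    have hh := hs.conjTranspose_eq
    have h0 := hs.isUnit_det
    obtain ⟨w, hw⟩ := exists_hankelMat_one_mulVec (hs.firstTransform n).2
    -- The weight `G T s_0` starts with `1`; the remainder comes from `G = 1 + zXG` and `T s_0 = 1 -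
    -- X s_0⁻¹ S'` up to the central factor `G`.
    have hF : geomSeries q z * PowerSeries.mk (reciprocalSeq s) * C (s 0) = C 1 + X *
        (C (z • 1) * geomSeries q z -
          C (s 0)⁻¹ * (PowerSeries.mk (firstTransform s) * geomSeries q z)) := by
      have hX : X * (C (s 0)⁻¹ * (PowerSeries.mk (firstTransform s) * geomSeries q z)) =
          geomSeries q z - PowerSeries.mk (reciprocalSeq s) * C (s 0) * geomSeries q z := by
        rw [← mul_assoc, X_mul, mul_assoc, ← mul_assoc X, X_mul_mk_firstTransform h0,
          sub_mul, mul_sub]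
        simp only [← mul_assoc]
        rw [C_inv_mul_C h0, one_mul, one_mul]
      rw [mul_sub, hX, ← add_sub_assoc, map_one, ← geomSeries_eq, mul_assoc,
        ← mul_geomSeries_comm]
      abel
    rw [gammaPoly_mul (hs (n + 1)).1 (hankelMat_succ_mulVec hh h0 hw),
      upperToeplitz_mulVec_mulVec, upperToeplitz_mulVec_cons hF, upperToeplitz_sub_mulVec_zero,
      upperToeplitz_C_mul_mulVec_zero, upperToeplitz_C_mul_mulVec_zero,
      betaPoly_succ hs.firstTransform.conjTranspose_eq (hs.firstTransform n).2 hw,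
      deltaPoly_succ (hs.firstTransform n).2 hw, Matrix.smul_mul, one_mul, sub_sub_eq_add_sub,
      ← sub_add_eq_add_sub]

/-! ### The one-step factorization -/

theorem factorQ_mul_inv (h0 : IsUnit (s 0).det) (hs : (s 0)ᴴ = s 0) {z : ℂ} (hz : z ≠ 0) :
    factorQ s z * Matrix.fromBlocks 0 (-(z⁻¹ • s 0)) (s 0)⁻¹ 0 = 1 := by
  rw [factorQ, Matrix.fromBlocks_multiply, ← Matrix.fromBlocks_one,
    Matrix.conjTranspose_nonsing_inv, hs]
  congr 1 <;> simp [Matrix.mul_nonsing_inv _ h0, Matrix.nonsing_inv_mul _ h0, smul_smul, hz]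

theorem isUnit_factorQ (hs : IsStieltjesPosDef s) {z : ℂ} (hz : z ≠ 0) : IsUnit (factorQ s z) :=
  IsUnit.of_mul_eq_one _ (factorQ_mul_inv hs.isUnit_det (hs.conjTranspose_eq 0) hz)

/-- Right multiplication by `Q` swaps the block columns, so `α, γ` of `s` meet `β, δ` of `s'` at
index `(m + 1) / 2`, and `β, δ` of `s` at index `m / 2 + 1` meet `α, γ` of `s'` at `m / 2`. As `Q`
is not inverted, `z = 0` is allowed. -/
theorem dyukarevU_succ_mul_factorQ (hs : IsStieltjesPosDef s) (m : ℕ) (z : ℂ) :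
    dyukarevU s (m + 1) z * factorQ s z =
      dyukarevU s 0 z * factorQ s z * dyukarevU (firstTransform s) m z := by
  have h0 := hs.isUnit_det
  have hu : IsUnit (s 0) := (Matrix.isUnit_iff_isUnit_det _).2 h0
  have hγ : gammaPoly s 0 z = -(z • (s 0)⁻¹) := by
    refine hu.mul_right_cancel ?_
    rw [gammaPoly_zero hs, neg_mul, Matrix.smul_mul, Matrix.nonsing_inv_mul _ h0]
  have hα : alphaPoly s 0 z = 1 := by
    refine hu.mul_right_cancel ?_
    rw [alphaPoly_mul_eq hs, deltaPoly, mul_one, one_mul]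
  have hA := alphaPoly_firstTransform_mul hs (m / 2) z
  have hC := gammaPoly_firstTransform_mul hs (m / 2) z
  have hA2 := alphaPoly_mul_eq hs ((m + 1) / 2) z
  have hC2 := gammaPoly_mul_eq hs ((m + 1) / 2) z
  have hA' : alphaPoly (firstTransform s) (m / 2) z =
      (s 0 * deltaPoly s (m / 2 + 1) z + z • betaPoly s (m / 2 + 1) z) * (s 0)⁻¹ := by
    rw [← hA, mul_assoc, Matrix.mul_nonsing_inv _ h0, mul_one]
  have hC' : gammaPoly (firstTransform s) (m / 2) z =
      -(z • ((s 0)⁻¹ * betaPoly s (m / 2 + 1) z)) * (s 0)⁻¹ := by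
    rw [← hC, mul_assoc, Matrix.mul_nonsing_inv _ h0, mul_one]
  simp only [dyukarevU, factorQ, Nat.zero_div, zero_add, Nat.reduceDiv, hα, hγ, betaPoly.eq_1,
    deltaPoly.eq_1, Matrix.fromBlocks_multiply, Matrix.conjTranspose_nonsing_inv,
    hs.conjTranspose_eq 0, show (m + 1 + 1) / 2 = m / 2 + 1 by omega, hA2, hC2, hA', hC']
  congr 1
  · simp only [mul_zero, zero_add, add_zero, one_mul, zero_mul, mul_neg, neg_mul, neg_zero,
      Matrix.mul_smul, Matrix.smul_mul, Matrix.mul_nonsing_inv_cancel_left _ _ h0, mul_assoc]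
  · simp
  · simp only [mul_zero, zero_add, add_zero, one_mul, mul_neg, neg_mul,
      Matrix.mul_smul, Matrix.smul_mul, Matrix.nonsing_inv_mul_cancel_left _ _ h0, mul_assoc,
      Matrix.nonsing_inv_mul _ h0, add_mul, mul_add, neg_neg]
    abel
  · simp only [mul_zero, add_zero, zero_add, one_mul, neg_mul,
      Matrix.smul_mul, Matrix.nonsing_inv_mul _ h0, smul_add, neg_add]
    abel

/-! ### Telescoping over the transforms -/

theorem transform_succ' (s : ℕ → Matrix (Fin q) (Fin q) ℂ) (k : ℕ) :
    transform s (k + 1) = transform (firstTransform s) k := by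
  induction k with
  | zero => rfl
  | succ k ih => rw [transform, ih, transform]

/-- The definition splits off the last factor; the induction needs the first one, so that the rest
belongs to `firstTransform s`. -/
theorem frakQ_succ' (s : ℕ → Matrix (Fin q) (Fin q) ℂ) (l : ℕ) (z : ℂ) :
    frakQ s (l + 1) z = factorQ s z * frakQ (firstTransform s) l z := by
  induction l with
  | zero => rfl
  | succ l ih => rw [frakQ, ih, frakQ, mul_assoc, transform_succ']

theorem isUnit_frakQ (hs : IsStieltjesPosDef s) (l : ℕ) {z : ℂ} (hz : z ≠ 0) :
    IsUnit (frakQ s l z) := by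
  induction l with
  | zero => exact isUnit_factorQ hs hz
  | succ l ih => exact ih.mul (isUnit_factorQ (hs.transform (l + 1)) hz)

/-- The one-step relation is used twice: to pass from `s` to its transform, where the induction
hypothesis applies, and backwards to absorb `U_0(s) Q U_l(s')` into `U_{l+1}(s) Q`. -/
theorem dyukarevU_mul_frakQ (hs : IsStieltjesPosDef s) (l d : ℕ) (z : ℂ) :
    dyukarevU s (l + 1 + d) z * frakQ s l z =
      dyukarevU s l z * frakQ s l z * dyukarevU (transform s (l + 1)) d z := by
  induction l generalizing s with
  | zero =>
    rw [show 0 + 1 + d = d + 1 by omega]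
    exact dyukarevU_succ_mul_factorQ hs d z
  | succ l ih =>
    rw [show l + 1 + 1 + d = l + 1 + d + 1 by omega, frakQ_succ', ← mul_assoc,
      dyukarevU_succ_mul_factorQ hs, mul_assoc (_ * _), ih hs.firstTransform, ← mul_assoc,
      ← mul_assoc, ← mul_assoc, dyukarevU_succ_mul_factorQ hs l, transform_succ' s (l + 1)]

end Recursion

end StieltjesResolvent

end

theorem mainTheorem1 {q : ℕ} (s : ℕ → Matrix (Fin q) (Fin q) ℂ)
    (hs : StieltjesResolvent.IsStieltjesPosDef s) :
    (∀ k : ℕ, StieltjesResolvent.IsStieltjesPosDef (StieltjesResolvent.transform s k)) ∧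
    ∀ m : ℕ, 1 ≤ m → ∀ l : ℕ, l < m → ∀ z : ℂ, z ≠ 0 →
      IsUnit (StieltjesResolvent.frakQ s l z) ∧
      StieltjesResolvent.resolventU s 0 m z =
        StieltjesResolvent.resolventU s 0 l z * StieltjesResolvent.frakQ s l z *
          StieltjesResolvent.resolventU s (l + 1) m z * (StieltjesResolvent.frakQ s l z)⁻¹ := by
  refine ⟨hs.transform, fun m _ l hl z hz => ?_⟩
  have hQ := StieltjesResolvent.isUnit_frakQ hs l hz
  refine ⟨hQ, ?_⟩
  have h := StieltjesResolvent.dyukarevU_mul_frakQ hs l (m - (l + 1)) z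
  rw [show l + 1 + (m - (l + 1)) = m by omega] at h
  change StieltjesResolvent.dyukarevU s m z = StieltjesResolvent.dyukarevU s l z *
    StieltjesResolvent.frakQ s l z * StieltjesResolvent.dyukarevU
      (StieltjesResolvent.transform s (l + 1)) (m - (l + 1)) z * _
  rw [← h, Matrix.mul_assoc,
    Matrix.mul_nonsing_inv _ ((Matrix.isUnit_iff_isUnit_det _).1 hQ), Matrix.mul_one]
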